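/- Let $n \ge 1$ and $0 \le m \le n$ be integers and write $[n]=\{1,\dots,n\}$. Let $D$ be a digraph with vertex set $[n]$ (loops allowed) and let $s=(s_1,\dots,s_m)\in[n]^m$. The drivers $1,\dots,m$ enter one after the other. Driver $i$ starts at the vertex $s_i$. If her current vertex is unoccupied, she parks there; if it is occupied, she chooses an out-neighbour of it, drives there, and repeats. The sequence $s$ is called a parking function on $D$ if it is possible (for some choices of the drivers) that all $m$ drivers park. Let $P(D,m)$ be the number of $s\in[n]^m$ that are parking functions on $D$. Let $\widetilde{\mathcal T}_n$ be the set of source trees on $[n]$, that is, of rooted trees with vertex set $[n]$ in which every edge is directed away from the root. For $f:[n]\to[n]$, the inverse mapping digraph $\widetilde M_f$ is the digraph with vertex set $[n]$ and edge set $\{(f(i),i): i\in[n]\}$; let $\widetilde{\mathcal M}_n$ be the set of the digraphs $\widetilde M_f$ for all $f:[n]\to[n]$. Put \[ \widetilde F_{n,m}=\sum_{T\in\widetilde{\mathcal T}_n}P(T,m),\qquad \widetilde M_{n,m}=\sum_{M\in\widetilde{\mathcal M}_n}P(M,m). \] Then \[ n\cdot\widetilde F_{n,m}=\widetilde M_{n,m}.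 \] -/

import Mathlib

namespace DigraphParking

/-- `ParksAt D occ v x`: a driver currently at vertex `v`, on the digraph `D` whose set of occupied
vertices is `occ`, can end up parking at `x`.  At an unoccupied vertex she parks at once; at an
occupied one she chooses an out-neighbour, drives there and repeats. -/
inductive ParksAt {V : Type*} (D : Digraph V) (occ : Set V) : V → V → Prop
  | park {v : V} (hv : v ∉ occ) : ParksAt D occ v v
  | drive {v w x : V} (hv : v ∈ occ) (hvw : D.Adj v w) (hw : ParksAt D occ w x) :
      ParksAt D occ v x

/-- `s` is a parking function on `D`: the `m` drivers, entering one after the other, can all park.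
Here `p i` is the vertex where driver `i` parks, so that the vertices occupied when driver `i`
enters are the `p j` with `j < i`. -/
def IsParkingFunction {V : Type*} (D : Digraph V) {m : ℕ} (s : Fin m → V) : Prop :=
  ∃ p : Fin m → V, ∀ i : Fin m, ParksAt D {x | ∃ j : Fin m, j < i ∧ p j = x} (s i) (p i)

/-- `P(D, m)`: the number of sequences of length `m` that are parking functions on `D`. -/
noncomputable def numParking {n : ℕ} (D : Digraph (Fin n)) (m : ℕ) : ℕ :=
  Nat.card {s : Fin m → Fin n // IsParkingFunction D s}

/-- A source tree: a rooted tree with all edges oriented away from the root.  The root has no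
incoming edge, every other vertex has exactly one (from its parent), and every vertex can be
reached from the root by a directed path. -/
def IsSourceTree {V : Type*} (D : Digraph V) : Prop :=
  ∃ r : V, (∀ u, ¬ D.Adj u r) ∧ (∀ v, v ≠ r → ∃! u, D.Adj u v) ∧
    ∀ v, Relation.ReflTransGen D.Adj r v

/-- The inverse mapping digraph of `f`, with the edges `(f i, i)`. -/
def inverseMappingDigraph {V : Type*} (f : V → V) : Digraph V where
  Adj u v := u = f v

/-- The set of all source trees with vertex set `Fin n`. -/
def sourceTrees (n : ℕ) : Set (Digraph (Fin n)) := {D | IsSourceTree D}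

/-- The set of all inverse mapping digraphs with vertex set `Fin n`. -/
def inverseMappings (n : ℕ) : Set (Digraph (Fin n)) := Set.range inverseMappingDigraph

open Classical in
/-- The number of pairs of a source tree on `Fin n` and a parking function of length `m` on it. -/
noncomputable def sourceTreeTotal (n m : ℕ) : ℕ :=
  ∑ D : Digraph (Fin n) with D ∈ sourceTrees n, numParking D m

open Classical in
/-- The number of pairs of an inverse mapping digraph on `Fin n` and a parking function of
length `m` on it. -/
noncomputable def inverseMappingTotal (n m : ℕ) : ℕ :=
  ∑ D : Digraph (Fin n) with D ∈ inverseMappings n, numParking D m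

end DigraphParking

/-!
A sequence of starting vertices is a parking function if and only if the drivers can be assigned
distinct vertices within their reach: a driver who parks early at the vertex assigned to another one
leaves her own vertex to that driver.  Let every vertex have weight one minus the number of drivers
who start there.  In a source tree or an inverse mapping digraph with parent map `f`, Hall's theorem
turns the condition into: for every vertex, the total weight of its descendants is nonnegative.

The factor `n` marks a vertex `w` of the tree.  Turning the vertices on the path from `w` to the
root into roots leaves a forest, and so does turning the periodic points of a map into roots.  Give
each root of the forest the total weight of its descendants.  The marked trees over a given forest
correspond to the orderings of its roots with nonnegative prefix sums, and the maps over it to the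
permutations of its roots with nonnegative cycle sums.  There are equally many of both: an ordering
is cut uniquely at its first minimal partial sum into an ordering with negative suffix sums and one
with nonnegative prefix sums, just as a permutation is the product of its negative cycles and its
nonnegative ones, and a nonempty set does not admit both kinds of orderings (or of cycles covering
it), so that these two decompositions determine the counts recursively.
-/

namespace DigraphParking

open Finset Function Equiv Relation
open scoped Classical Nat

section Descendants

variable {V M : Type*} [Fintype V] {f : V → V} {v x : V}

/-- The vertices from which iteration of `f` leads to `v`.  When `f` sends each vertex to its
parent, these are the descendants of `v`, including `v` itself. -/
noncomputable def descendants (f : V → V) (v : V) : Finset V := {x | ∃ k, f^[k] x = v}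

lemma mem_descendants : x ∈ descendants f v ↔ ∃ k, f^[k] x = v := by
  simp [descendants]

lemma self_mem_descendants (f : V → V) (v : V) : v ∈ descendants f v :=
  mem_descendants.2 ⟨0, rfl⟩

lemma mem_descendants_of_apply_mem (h : f x ∈ descendants f v) : x ∈ descendants f v := by
  obtain ⟨k, hk⟩ := mem_descendants.1 h
  exact mem_descendants.2 ⟨k + 1, hk⟩

lemma eq_or_apply_mem_of_mem_descendants (h : x ∈ descendants f v) :
    x = v ∨ f x ∈ descendants f v := by
  obtain ⟨_ | k, hk⟩ := mem_descendants.1 h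
  · exact .inl hk
  · exact .inr (mem_descendants.2 ⟨k, hk⟩)

lemma descendants_subset_of_mem (h : x ∈ descendants f v) :
    descendants f x ⊆ descendants f v := by
  intro y hy
  obtain ⟨i, rfl⟩ := mem_descendants.1 hy
  obtain ⟨j, rfl⟩ := mem_descendants.1 h
  exact mem_descendants.2 ⟨j + i, iterate_add_apply f j i y⟩

lemma mem_descendants_perm {σ : Perm V} : x ∈ descendants σ v ↔ σ.SameCycle x v := by
  rw [mem_descendants]
  constructor
  · rintro ⟨k, rfl⟩
    exact ⟨k, by simp [Perm.iterate_eq_pow]⟩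
  · intro h
    obtain ⟨k, hk⟩ := h.exists_nat_pow_eq
    exact ⟨k, by rw [Perm.iterate_eq_pow, hk]⟩

/-- The total weight of the descendants of `v`. -/
noncomputable def descendantSum [AddCommMonoid M] (f : V → V) (d : V → M) (v : V) : M :=
  ∑ x ∈ descendants f v, d x

/-- The set `W` splits into sets of descendants: the descendants of a vertex of `W` with the most
descendants can be removed from `W`. -/
lemma sum_mem_of_forall_descendantSum_mem [AddCommMonoid M] (A : AddSubsemigroup M) {d : V → M}
    {W : Finset V} (hne : W.Nonempty) (hW : ∀ x, f x ∈ W → x ∈ W)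
    (hA : ∀ v ∈ W, descendantSum f d v ∈ A) : ∑ x ∈ W, d x ∈ A := by
  induction W using Finset.strongInduction with
  | H W ih =>
  obtain ⟨v, hv, hmax⟩ := exists_max_image W (fun v => #(descendants f v)) hne
  have hsub : descendants f v ⊆ W := by
    intro x hx
    obtain ⟨k, hk⟩ := mem_descendants.1 hx
    induction k generalizing x with
    | zero =>
      obtain rfl : x = v := hk
      exact hv
    | succ k ih => exact hW x (ih (mem_descendants.2 ⟨k, hk⟩) hk)
  have hfv (h : f v ∈ W) : f v ∈ descendants f v := by
    have hle : descendants f v ⊆ descendants f (f v) :=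
      descendants_subset_of_mem (mem_descendants_of_apply_mem (self_mem_descendants f _))
    rw [eq_of_subset_of_card_le hle (hmax _ h)]
    exact self_mem_descendants f _
  rw [← sum_sdiff hsub]
  rcases (W \ descendants f v).eq_empty_or_nonempty with he | hne'
  · rw [he, sum_empty, zero_add]
    exact hA v hv
  refine A.add_mem (ih _ (sdiff_ssubset hsub ⟨v, self_mem_descendants f v⟩) hne' (fun x hx => ?_)
    fun x hx => hA x (mem_sdiff.1 hx).1) (hA v hv)
  rw [mem_sdiff] at hx ⊢
  refine ⟨hW x hx.1, fun hxv => ?_⟩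
  rcases eq_or_apply_mem_of_mem_descendants hxv with rfl | h
  · exact hx.2 (hfv hx.1)
  · exact hx.2 h

end Descendants

section Orderings

variable {V M : Type*}

/-- The linear orderings of `S`, as lists. -/
noncomputable def orderings (S : Finset V) : Finset (List V) :=
  ⟨S.val.lists, Multiset.lists_nodup_finset S⟩

lemma mem_orderings {S : Finset V} {l : List V} : l ∈ orderings S ↔ l.Nodup ∧ l.toFinset = S := by
  rw [← mem_val, orderings, Multiset.mem_lists_iff]
  constructor
  · intro h
    have hl : l.Nodup := by
      rw [← Multiset.coe_nodup, ← Multiset.quot_mk_to_coe, ← h]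
      exact S.nodup
    refine ⟨hl, val_injective ?_⟩
    rw [List.toFinset_val, hl.dedup]
    exact h.symm
  · rintro ⟨hl, rfl⟩
    rw [List.toFinset_val, hl.dedup]
    rfl

lemma card_orderings (S : Finset V) : #(orderings S) = (#S)! := by
  rw [orderings, card_mk, ← coe_toList, Multiset.lists_coe, Multiset.coe_card,
    List.length_permutations, length_toList]

variable [AddCommMonoid M] [LinearOrder M] {c : V → M}

/-- All prefixes of `l` have nonnegative weight. -/
def HasNonnegPrefixes (c : V → M) (l : List V) : Prop := ∀ t, t <+: l → 0 ≤ (t.map c).sum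

/-- All nonempty suffixes of `l` have negative weight. -/
def HasNegSuffixes (c : V → M) (l : List V) : Prop :=
  ∀ t, t <:+ l → t ≠ [] → (t.map c).sum < 0

/-- The list is cut where its partial sums attain their minimum for the first time. -/
lemma exists_append_hasNegSuffixes_hasNonnegPrefixes [IsOrderedAddMonoid M] (c : V → M)
    (l : List V) : ∃ u v, u ++ v = l ∧ HasNegSuffixes c u ∧ HasNonnegPrefixes c v := by
  induction l with
  | nil => exact ⟨[], [], by simp [HasNegSuffixes, HasNonnegPrefixes]⟩
  | cons a l ih =>
    obtain ⟨u, v, rfl, hu, hv⟩ := ih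
    by_cases h : c a + (u.map c).sum < 0
    · refine ⟨a :: u, v, rfl, fun t ht hne => ?_, hv⟩
      rcases List.suffix_cons_iff.1 ht with rfl | ht
      · simpa using h
      · exact hu t ht hne
    refine ⟨[], a :: (u ++ v), rfl, by simp [HasNegSuffixes], fun t ht => ?_⟩
    rw [not_lt] at h
    rcases List.prefix_cons_iff.1 ht with rfl | ⟨t, rfl, ht'⟩
    · simp
    rw [List.map_cons, List.sum_cons]
    rcases List.prefix_or_prefix_of_prefix ht' (List.prefix_append u v) with ⟨w, rfl⟩ | ⟨w, rfl⟩
    · have hw : (w.map c).sum ≤ 0 := by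
        rcases eq_or_ne w [] with rfl | hw
        · simp
        · exact (hu w (List.suffix_append _ _) hw).le
      rw [List.map_append, List.sum_append, ← add_assoc] at h
      exact h.trans (add_le_of_nonpos_right hw)
    · rw [List.map_append, List.sum_append, ← add_assoc]
      exact add_nonneg h (hv w ((List.prefix_append_right_inj u).1 ht'))

lemma append_injective_of_hasNegSuffixes_hasNonnegPrefixes {u v u' v' : List V}
    (h : u ++ v = u' ++ v') (hu : HasNegSuffixes c u) (hv : HasNonnegPrefixes c v)
    (hu' : HasNegSuffixes c u') (hv' : HasNonnegPrefixes c v') : u = u' ∧ v = v' := by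
  rcases List.append_eq_append_iff.1 h with ⟨t, rfl, rfl⟩ | ⟨t, rfl, rfl⟩ <;>
    rcases eq_or_ne t [] with rfl | ht
  · simp
  · exact absurd (hv t (List.prefix_append _ _)) (hu' t (List.suffix_append _ _) ht).not_ge
  · simp
  · exact absurd (hv' t (List.prefix_append _ _)) (hu t (List.suffix_append _ _) ht).not_ge

/-- The orderings of `S` all of whose prefixes have nonnegative weight. -/
noncomputable def nonnegOrderings (c : V → M) (S : Finset V) : Finset (List V) :=
  {l ∈ orderings S | HasNonnegPrefixes c l}

/-- The orderings of `S` all of whose nonempty suffixes have negative weight. -/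
noncomputable def negOrderings (c : V → M) (S : Finset V) : Finset (List V) :=
  {l ∈ orderings S | HasNegSuffixes c l}

lemma mem_nonnegOrderings {S : Finset V} {l : List V} :
    l ∈ nonnegOrderings c S ↔ (l.Nodup ∧ l.toFinset = S) ∧ HasNonnegPrefixes c l := by
  rw [nonnegOrderings, mem_filter, mem_orderings]

lemma mem_negOrderings {S : Finset V} {l : List V} :
    l ∈ negOrderings c S ↔ (l.Nodup ∧ l.toFinset = S) ∧ HasNegSuffixes c l := by
  rw [negOrderings, mem_filter, mem_orderings]

lemma nonnegOrderings_empty (c : V → M) : nonnegOrderings c ∅ = {[]} := by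
  ext l
  simp only [mem_nonnegOrderings, List.toFinset_eq_empty_iff, mem_singleton]
  exact ⟨fun h => h.1.2, by rintro rfl; simp [HasNonnegPrefixes]⟩

lemma negOrderings_empty (c : V → M) : negOrderings c ∅ = {[]} := by
  ext l
  simp only [mem_negOrderings, List.toFinset_eq_empty_iff, mem_singleton]
  exact ⟨fun h => h.1.2, by rintro rfl; simp [HasNegSuffixes]⟩

lemma nonnegOrderings_eq_empty {S : Finset V} (h : ∑ x ∈ S, c x < 0) :
    nonnegOrderings c S = ∅ := by
  refine eq_empty_of_forall_notMem fun l hl => ?_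
  obtain ⟨⟨hnd, rfl⟩, hprefix⟩ := mem_nonnegOrderings.1 hl
  rw [List.sum_toFinset c hnd] at h
  exact h.not_ge (hprefix l (List.prefix_refl l))

lemma negOrderings_eq_empty {S : Finset V} (hS : S.Nonempty) (h : 0 ≤ ∑ x ∈ S, c x) :
    negOrderings c S = ∅ := by
  refine eq_empty_of_forall_notMem fun l hl => ?_
  obtain ⟨⟨hnd, rfl⟩, hsuffix⟩ := mem_negOrderings.1 hl
  rw [List.sum_toFinset c hnd] at h
  exact h.not_gt (hsuffix l (List.suffix_refl l) (List.toFinset_nonempty_iff l |>.1 hS))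

lemma factorial_card_eq_sum_orderings [IsOrderedAddMonoid M] (c : V → M) (S : Finset V) :
    (#S)! = ∑ U ∈ S.powerset, #(negOrderings c U) * #(nonnegOrderings c (S \ U)) := by
  simp_rw [← card_orderings, ← card_product, ← card_sigma]
  symm
  refine card_nbij (fun a => a.2.1 ++ a.2.2) ?_ ?_ ?_
  · rintro ⟨U, u, v⟩ h
    simp only [mem_coe, mem_sigma, mem_powerset, mem_product, mem_negOrderings,
      mem_nonnegOrderings, mem_orderings] at h ⊢
    obtain ⟨hU, ⟨⟨hu, rfl⟩, -⟩, ⟨hv, hvS⟩, -⟩ := h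
    rw [List.toFinset_append, hvS, union_sdiff_of_subset hU, List.nodup_append',
      ← List.disjoint_toFinset_iff_disjoint, hvS]
    exact ⟨⟨hu, hv, disjoint_sdiff⟩, rfl⟩
  · rintro ⟨U, u, v⟩ h ⟨U', u', v'⟩ h' huv
    simp only [mem_coe, mem_sigma, mem_product, mem_negOrderings, mem_nonnegOrderings] at h h'
    obtain ⟨-, ⟨⟨-, rfl⟩, hu⟩, -, hv⟩ := h
    obtain ⟨-, ⟨⟨-, rfl⟩, hu'⟩, -, hv'⟩ := h'
    obtain ⟨rfl, rfl⟩ := append_injective_of_hasNegSuffixes_hasNonnegPrefixes huv hu hv hu' hv'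
    rfl
  · intro l hl
    obtain ⟨u, v, rfl, hu, hv⟩ := exists_append_hasNegSuffixes_hasNonnegPrefixes c l
    obtain ⟨hnd, rfl⟩ := mem_orderings.1 hl
    rw [List.nodup_append', ← List.disjoint_toFinset_iff_disjoint] at hnd
    refine ⟨⟨u.toFinset, u, v⟩, ?_, rfl⟩
    simp only [mem_coe, mem_sigma, mem_powerset, mem_product, mem_negOrderings,
      mem_nonnegOrderings, List.toFinset_append, union_sdiff_cancel_left hnd.2.2]
    exact ⟨subset_union_left, ⟨⟨hnd.1, trivial⟩, hu⟩, ⟨hnd.2.1, trivial⟩, hv⟩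

end Orderings

section Permutations

variable {V M : Type*} {S : Finset V} {σ τ ρ : Perm V} {x : V}

lemma mem_permsOfFinset_iff : σ ∈ permsOfFinset S ↔ ∀ x ∉ S, σ x = x := by
  simp only [mem_perms_of_finset_iff, not_imp_comm (b := σ _ = _)]

lemma apply_mem_iff_of_forall_notMem {P : Set V} (h : ∀ x ∉ P, σ x = x) : σ x ∈ P ↔ x ∈ P := by
  refine not_iff_not.1 ⟨fun hx => ?_, fun hx => by rwa [h x hx]⟩
  rwa [← σ.injective (h _ hx)]

lemma apply_mem_iff_of_mem_permsOfFinset (h : σ ∈ permsOfFinset S) : σ x ∈ S ↔ x ∈ S := by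
  rw [← mem_coe, ← mem_coe, apply_mem_iff_of_forall_notMem (mem_permsOfFinset_iff.1 h)]

lemma disjoint_of_forall_notMem_of_forall_mem (hτ : ∀ x ∉ S, τ x = x) (hρ : ∀ x ∈ S, ρ x = x) :
    τ.Disjoint ρ := fun x => (em (x ∈ S)).symm.imp (hτ x) (hρ x)

lemma exists_mul_eq_of_forall_apply_mem_iff (hσ : ∀ x, σ x ∈ S ↔ x ∈ S) :
    ∃ τ ρ : Perm V, τ * ρ = σ ∧ (∀ x ∉ S, τ x = x) ∧ ∀ x ∈ S, ρ x = x := by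
  refine ⟨Perm.ofSubtype (σ.subtypePerm hσ), (Perm.ofSubtype (σ.subtypePerm hσ))⁻¹ * σ,
    mul_inv_cancel_left _ _, fun x hx => Perm.ofSubtype_apply_of_not_mem _ hx, fun x hx => ?_⟩
  rw [Perm.mul_apply, Perm.inv_eq_iff_eq, Perm.ofSubtype_apply_of_mem _ hx]
  rfl

lemma eq_and_eq_of_mul_eq_mul {τ' ρ' : Perm V} (h : τ * ρ = τ' * ρ') (hτ : ∀ x ∉ S, τ x = x)
    (hρ : ∀ x ∈ S, ρ x = x) (hτ' : ∀ x ∉ S, τ' x = x) (hρ' : ∀ x ∈ S, ρ' x = x) :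
    τ = τ' ∧ ρ = ρ' := by
  obtain rfl : τ = τ' := by
    ext x
    by_cases hx : x ∈ S
    · simpa [hρ x hx, hρ' x hx] using congrArg (· x) h
    · rw [hτ x hx, hτ' x hx]
  exact ⟨rfl, mul_left_cancel h⟩

variable [Fintype V]

lemma descendants_mul_of_disjoint (h : τ.Disjoint ρ) (hx : ρ x = x) :
    descendants (τ * ρ) x = descendants τ x := by
  ext y
  rw [mem_descendants_perm, mem_descendants_perm, Perm.sameCycle_comm, Perm.sameCycle_comm (f := τ)]
  refine exists_congr fun k => ?_
  rw [h.commute.mul_zpow, Perm.mul_apply, Perm.zpow_apply_eq_self_of_apply_eq_self hx]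

lemma descendantSum_perm_apply [AddCommMonoid M] (σ : Perm V) (c : V → M) (x : V) :
    descendantSum σ c (σ x) = descendantSum σ c x :=
  sum_congr (by ext y; simp [mem_descendants_perm]) fun _ _ => rfl

variable [AddCommMonoid M] [LinearOrder M] {c : V → M}

/-- The permutations of `S` all of whose cycles have nonnegative weight, encoded as permutations of
`V` that fix the complement of `S`.  The cycle of `x` under `σ` is `descendants σ x`. -/
noncomputable def nonnegPerms (c : V → M) (S : Finset V) : Finset (Perm V) :=
  {σ ∈ permsOfFinset S | ∀ x ∈ S, 0 ≤ descendantSum σ c x}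

/-- The permutations of `S` all of whose cycles have negative weight, encoded as in
`nonnegPerms`. -/
noncomputable def negPerms (c : V → M) (S : Finset V) : Finset (Perm V) :=
  {σ ∈ permsOfFinset S | ∀ x ∈ S, descendantSum σ c x < 0}

lemma mem_nonnegPerms :
    σ ∈ nonnegPerms c S ↔ (∀ x ∉ S, σ x = x) ∧ ∀ x ∈ S, 0 ≤ descendantSum σ c x := by
  rw [nonnegPerms, mem_filter, mem_permsOfFinset_iff]

lemma mem_negPerms :
    σ ∈ negPerms c S ↔ (∀ x ∉ S, σ x = x) ∧ ∀ x ∈ S, descendantSum σ c x < 0 := by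
  rw [negPerms, mem_filter, mem_permsOfFinset_iff]

lemma nonnegPerms_empty (c : V → M) : nonnegPerms c ∅ = {1} := by
  ext σ
  simp [mem_nonnegPerms, Equiv.ext_iff]

lemma negPerms_empty (c : V → M) : negPerms c ∅ = {1} := by
  ext σ
  simp [mem_negPerms, Equiv.ext_iff]

lemma nonnegPerms_eq_empty [IsOrderedAddMonoid M] (h : ∑ x ∈ S, c x < 0) : nonnegPerms c S = ∅ := by
  refine eq_empty_of_forall_notMem fun σ hσ => h.not_ge ?_
  have hS : S.Nonempty := nonempty_of_sum_ne_zero h.ne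
  have hmem : σ ∈ permsOfFinset S := (mem_filter.1 hσ).1
  exact sum_mem_of_forall_descendantSum_mem (AddSubmonoid.nonneg M).toAddSubsemigroup hS
    (fun x => (apply_mem_iff_of_mem_permsOfFinset hmem).1) (mem_nonnegPerms.1 hσ).2

lemma negPerms_eq_empty [IsOrderedAddMonoid M] (hS : S.Nonempty) (h : 0 ≤ ∑ x ∈ S, c x) :
    negPerms c S = ∅ := by
  refine eq_empty_of_forall_notMem fun σ hσ => h.not_gt ?_
  have hmem : σ ∈ permsOfFinset S := (mem_filter.1 hσ).1
  exact sum_mem_of_forall_descendantSum_mem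
    ⟨Set.Iio 0, fun hx hy => add_neg_of_neg_of_nonpos hx hy.le⟩ hS
    (fun x => (apply_mem_iff_of_mem_permsOfFinset hmem).1) (mem_negPerms.1 hσ).2

lemma eq_filter_of_mem_negPerms_of_mem_nonnegPerms {U : Finset V} (hU : U ⊆ S)
    (hτ : τ ∈ negPerms c U) (hρ : ρ ∈ nonnegPerms c (S \ U)) :
    U = {x ∈ S | descendantSum (τ * ρ) c x < 0} := by
  rw [mem_negPerms] at hτ
  rw [mem_nonnegPerms] at hρ
  have hρU : ∀ x ∈ U, ρ x = x := fun x hx => hρ.1 x fun h => (mem_sdiff.1 h).2 hx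
  have hdisj : τ.Disjoint ρ := disjoint_of_forall_notMem_of_forall_mem hτ.1 hρU
  ext x
  rw [mem_filter]
  by_cases hx : x ∈ U
  · rw [descendantSum, descendants_mul_of_disjoint hdisj (hρU x hx)]
    exact iff_of_true hx ⟨hU hx, hτ.2 x hx⟩
  · rw [descendantSum, hdisj.commute.eq, descendants_mul_of_disjoint hdisj.symm (hτ.1 x hx)]
    exact iff_of_false hx fun h => h.2.not_ge (hρ.2 x (mem_sdiff.2 ⟨h.1, hx⟩))

lemma exists_mul_eq_mem_negPerms_mem_nonnegPerms (c : V → M) (hσ : σ ∈ permsOfFinset S) :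
    ∃ U ⊆ S, ∃ τ ∈ negPerms c U, ∃ ρ ∈ nonnegPerms c (S \ U), τ * ρ = σ := by
  obtain ⟨τ, ρ, rfl, hτ, hρ⟩ :=
    exists_mul_eq_of_forall_apply_mem_iff (σ := σ) (S := {x ∈ S | descendantSum σ c x < 0})
      fun x => by
        simp only [mem_filter, descendantSum_perm_apply, apply_mem_iff_of_mem_permsOfFinset hσ]
  have hdisj : τ.Disjoint ρ := disjoint_of_forall_notMem_of_forall_mem hτ hρ
  refine ⟨_, filter_subset _ S, τ, mem_negPerms.2 ⟨hτ, fun x hx => ?_⟩, ρ,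
    mem_nonnegPerms.2 ⟨fun x hx => ?_, fun x hx => ?_⟩, rfl⟩
  · rw [descendantSum, ← descendants_mul_of_disjoint hdisj (hρ x hx)]
    exact (mem_filter.1 hx).2
  · by_cases hxU : x ∈ ({x ∈ S | descendantSum (τ * ρ) c x < 0} : Finset V)
    · exact hρ x hxU
    · have hfix : (τ * ρ) x = x := mem_permsOfFinset_iff.1 hσ x fun h => hx (mem_sdiff.2 ⟨h, hxU⟩)
      rwa [hdisj.commute.eq, Perm.mul_apply, hτ x hxU] at hfix
  · rw [mem_sdiff] at hx
    rw [descendantSum, ← descendants_mul_of_disjoint hdisj.symm (hτ x hx.2), ← hdisj.commute.eq]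
    exact not_lt.1 fun h => hx.2 (mem_filter.2 ⟨hx.1, h⟩)

lemma factorial_card_eq_sum_perms (c : V → M) (S : Finset V) :
    (#S)! = ∑ U ∈ S.powerset, #(negPerms c U) * #(nonnegPerms c (S \ U)) := by
  simp_rw [← card_perms_of_finset, ← card_product, ← card_sigma]
  symm
  refine card_nbij (fun a => a.2.1 * a.2.2) ?_ ?_ ?_
  · rintro ⟨U, τ, ρ⟩ h
    simp only [mem_coe, mem_sigma, mem_powerset, mem_product, mem_negPerms, mem_nonnegPerms,
      mem_permsOfFinset_iff] at h ⊢
    obtain ⟨hU, hτ, hρ⟩ := h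
    intro x hx
    rw [Perm.mul_apply, hρ.1 x fun h => hx (mem_sdiff.1 h).1, hτ.1 x fun h => hx (hU h)]
  · rintro ⟨U, τ, ρ⟩ h ⟨U', τ', ρ'⟩ h' heq
    simp only [mem_coe, mem_sigma, mem_powerset, mem_product] at h h'
    change τ * ρ = τ' * ρ' at heq
    obtain rfl : U = U' := by
      rw [eq_filter_of_mem_negPerms_of_mem_nonnegPerms h.1 h.2.1 h.2.2,
        eq_filter_of_mem_negPerms_of_mem_nonnegPerms h'.1 h'.2.1 h'.2.2, heq]
    simp only [mem_negPerms, mem_nonnegPerms] at h h'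
    obtain ⟨rfl, rfl⟩ := eq_and_eq_of_mul_eq_mul heq h.2.1.1
      (fun x hx => h.2.2.1 x fun hS => (mem_sdiff.1 hS).2 hx) h'.2.1.1
      fun x hx => h'.2.2.1 x fun hS => (mem_sdiff.1 hS).2 hx
    rfl
  · intro σ hσ
    obtain ⟨U, hU, τ, hτ, ρ, hρ, rfl⟩ := exists_mul_eq_mem_negPerms_mem_nonnegPerms c hσ
    exact ⟨⟨U, τ, ρ⟩, mem_sigma.2 ⟨mem_powerset.2 hU, mem_product.2 ⟨hτ, hρ⟩⟩, rfl⟩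

end Permutations

section Spitzer

variable {V M : Type*}

/-- On both sides the terms with `U = ∅` and `U = S` are the only ones that involve `S`, and
one of them vanishes. -/
lemma eq_and_eq_of_sum_powerset_mul_eq {R : Type*} [Semiring R] [IsCancelAdd R]
    {a b a' b' : Finset V → R}
    (h : ∀ S, ∑ U ∈ S.powerset, a U * b (S \ U) = ∑ U ∈ S.powerset, a' U * b' (S \ U))
    (ha : a ∅ = 1) (hb : b ∅ = 1) (ha' : a' ∅ = 1) (hb' : b' ∅ = 1)
    (hzero : ∀ S : Finset V, S.Nonempty → a S = 0 ∧ a' S = 0 ∨ b S = 0 ∧ b' S = 0)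
    (S : Finset V) : a S = a' S ∧ b S = b' S := by
  induction S using Finset.strongInduction with
  | H S ih =>
  rcases S.eq_empty_or_nonempty with rfl | hS
  · exact ⟨ha.trans ha'.symm, hb.trans hb'.symm⟩
  have hsplit (F : Finset V → R) : ∑ U ∈ S.powerset, F U =
      F S + F ∅ + ∑ U ∈ (S.powerset.erase S).erase ∅, F U := by
    rw [add_assoc, add_sum_erase _ _ (mem_erase.2 ⟨hS.ne_empty.symm, empty_mem_powerset S⟩),
      add_sum_erase _ _ (mem_powerset_self S)]
  have hproper : ∑ U ∈ (S.powerset.erase S).erase ∅, a U * b (S \ U) =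
      ∑ U ∈ (S.powerset.erase S).erase ∅, a' U * b' (S \ U) := by
    refine sum_congr rfl fun U hU => ?_
    simp only [mem_erase, mem_powerset] at hU
    rw [(ih U (hU.2.2.ssubset_of_ne hU.2.1)).1,
      (ih (S \ U) (sdiff_ssubset hU.2.2 (nonempty_iff_ne_empty.2 hU.1))).2]
  have hS' := h S
  rw [hsplit, hsplit, hproper] at hS'
  have hsum : a S + b S = a' S + b' S := by
    simpa [ha, hb, ha', hb'] using add_right_cancel hS'
  rcases hzero S hS with ⟨h0, h0'⟩ | ⟨h0, h0'⟩ <;> simpa [h0, h0'] using hsum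

/-- A form of Spitzer's combinatorial lemma.  Both families occur in the same way in a
factorization of `(#S)!`, which determines their cardinalities. -/
theorem card_nonnegOrderings_eq_card_nonnegPerms [Fintype V] [AddCommMonoid M] [LinearOrder M]
    [IsOrderedAddMonoid M] (c : V → M) (S : Finset V) :
    #(nonnegOrderings c S) = #(nonnegPerms c S) := by
  refine (eq_and_eq_of_sum_powerset_mul_eq (a := fun U => #(negOrderings c U))
    (a' := fun U => #(negPerms c U)) (b := fun U => #(nonnegOrderings c U))
    (b' := fun U => #(nonnegPerms c U))
    (fun T => (factorial_card_eq_sum_orderings c T).symm.trans (factorial_card_eq_sum_perms c T))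
    (by simp [negOrderings_empty]) (by simp [nonnegOrderings_empty])
    (by simp [negPerms_empty]) (by simp [nonnegPerms_empty]) (fun T hT => ?_) S).2
  rcases le_or_gt 0 (∑ x ∈ T, c x) with h | h
  · simp [negOrderings_eq_empty hT h, negPerms_eq_empty hT h]
  · simp [nonnegOrderings_eq_empty h, nonnegPerms_eq_empty h]

end Spitzer

section Cores

variable {V M : Type*} {f g h p : V → V} {P Q : Set V} {v x : V}

/-- The set `P` is invariant under `f`, and iteration of `f` leads every vertex into `P`.  Such sets
are the periodic points of a map and, in a tree, the vertices on the path from one vertex to the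
root. -/
structure IsCore (f : V → V) (P : Set V) : Prop where
  mapsTo : Set.MapsTo f P P
  exists_iterate_mem : ∀ v, ∃ k, f^[k] v ∈ P

lemma IsCore.mono (hQ : IsCore f Q) (hQP : Q ⊆ P) (hP : Set.MapsTo f P P) : IsCore f P :=
  ⟨hP, fun v => (hQ.exists_iterate_mem v).imp fun _ hk => hQP hk⟩

lemma IsCore.fixedPoints_subset (hP : IsCore f P) : fixedPoints f ⊆ P := by
  intro v hv
  obtain ⟨k, hk⟩ := hP.exists_iterate_mem v
  rwa [iterate_fixed hv] at hk

/-- A rooted forest, encoded by the map that sends each root to itself and every other vertex to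
its parent. -/
def IsForest (g : V → V) : Prop := IsCore g (fixedPoints g)

/-- A rooted tree, encoded in the same way as a rooted forest. -/
def IsTree (p : V → V) : Prop := ∃ r, IsCore p {r}

lemma IsTree.isCore_range_iterate (hp : IsTree p) (w : V) : IsCore p (Set.range (p^[·] w)) := by
  obtain ⟨r, hr⟩ := hp
  refine hr.mono (Set.singleton_subset_iff.2 (hr.exists_iterate_mem w)) ?_
  rintro _ ⟨k, rfl⟩
  exact ⟨k + 1, iterate_succ_apply' p k w⟩

/-- The map obtained from `f` by turning all elements of `P` into fixed points.  For a core `P`, it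
is a forest with the set of roots `P`. -/
noncomputable def contract (P : Set V) (f : V → V) : V → V := P.piecewise id f

/-- The map obtained from the forest `g` by letting `h` act on its roots.  This recovers a map from
its contraction to a core and its action there. -/
noncomputable def glue (h g : V → V) : V → V := (fixedPoints g).piecewise h g

lemma contract_of_mem (hv : v ∈ P) : contract P f v = v := Set.piecewise_eq_of_mem _ _ _ hv

lemma contract_of_notMem (hv : v ∉ P) : contract P f v = f v :=
  Set.piecewise_eq_of_notMem _ _ _ hv

lemma eqOn_glue (h g : V → V) : Set.EqOn (glue h g) h (fixedPoints g) := Set.piecewise_eqOn _ _ _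

lemma glue_of_notMem (hv : v ∉ fixedPoints g) : glue h g v = g v :=
  Set.piecewise_eq_of_notMem _ _ _ hv

lemma IsCore.fixedPoints_contract (hP : IsCore f P) : fixedPoints (contract P f) = P := by
  ext v
  by_cases hv : v ∈ P
  · exact iff_of_true (contract_of_mem hv) hv
  · rw [mem_fixedPoints, IsFixedPt, contract_of_notMem hv]
    exact iff_of_false (fun h => hv (hP.fixedPoints_subset h)) hv

lemma IsCore.isForest_contract (hP : IsCore f P) : IsForest (contract P f) := by
  refine ⟨fun v hv => by rwa [hv.eq], fun v => ?_⟩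
  rw [hP.fixedPoints_contract]
  obtain ⟨k, hk⟩ := hP.exists_iterate_mem v
  induction k generalizing v with
  | zero => exact ⟨0, hk⟩
  | succ k ih =>
    by_cases hv : v ∈ P
    · exact ⟨0, hv⟩
    · obtain ⟨j, hj⟩ := ih (f v) hk
      exact ⟨j + 1, by rwa [iterate_succ_apply, contract_of_notMem hv]⟩

lemma contract_glue (h g : V → V) : contract (fixedPoints g) (glue h g) = g := by
  ext v
  by_cases hv : v ∈ fixedPoints g
  · rw [contract_of_mem hv, hv.eq]
  · rw [contract_of_notMem hv, glue_of_notMem hv]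

lemma IsCore.glue_contract (hP : IsCore f P) (hf : Set.EqOn h f P) :
    glue h (contract P f) = f := by
  ext v
  by_cases hv : v ∈ P
  · rw [eqOn_glue h _ (contract_of_mem hv), hf hv]
  · rw [glue_of_notMem (by rwa [hP.fixedPoints_contract]), contract_of_notMem hv]

lemma IsForest.isCore_glue (hg : IsForest g) (hh : Set.MapsTo h (fixedPoints g) (fixedPoints g)) :
    IsCore (glue h g) (fixedPoints g) := by
  refine ⟨hh.congr (eqOn_glue h g).symm, fun v => ?_⟩
  obtain ⟨k, hk⟩ := hg.exists_iterate_mem v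
  induction k generalizing v with
  | zero => exact ⟨0, hk⟩
  | succ k ih =>
    by_cases hv : v ∈ fixedPoints g
    · exact ⟨0, hv⟩
    · obtain ⟨j, hj⟩ := ih (g v) hk
      exact ⟨j + 1, by rwa [iterate_succ_apply, glue_of_notMem hv]⟩

variable [Fintype V]

/-- The roots of the forest `g`, that is, its fixed points. -/
noncomputable def roots (g : V → V) : Finset V := {v | g v = v}

lemma mem_roots : v ∈ roots g ↔ v ∈ fixedPoints g := by
  rw [roots, mem_filter_univ]
  rfl

lemma IsForest.roots_nonempty [Nonempty V] (hg : IsForest g) : (roots g).Nonempty :=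
  (hg.exists_iterate_mem (Classical.arbitrary V)).elim fun _ hk => ⟨_, mem_roots.2 hk⟩

lemma descendants_contract_subset (P : Set V) (f : V → V) (v : V) :
    descendants (contract P f) v ⊆ descendants f v := by
  intro x hx
  obtain ⟨k, hk⟩ := mem_descendants.1 hx
  induction k generalizing x with
  | zero => exact mem_descendants.2 ⟨0, hk⟩
  | succ k ih =>
    have hmem := ih (mem_descendants.2 ⟨k, hk⟩) hk
    by_cases hxP : x ∈ P
    · rwa [contract_of_mem hxP] at hmem
    · rw [contract_of_notMem hxP] at hmem
      exact mem_descendants_of_apply_mem hmem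

lemma descendants_contract_of_notMem (hP : Set.MapsTo f P P) (hv : v ∉ P) :
    descendants (contract P f) v = descendants f v := by
  refine (descendants_contract_subset P f v).antisymm fun x hx => ?_
  obtain ⟨k, hk⟩ := mem_descendants.1 hx
  induction k generalizing x with
  | zero => exact mem_descendants.2 ⟨0, hk⟩
  | succ k ih =>
    have hxP : x ∉ P := fun hxP => hv (hk ▸ hP.iterate (k + 1) hxP)
    refine mem_descendants_of_apply_mem ?_
    rw [contract_of_notMem hxP]
    exact ih _ (mem_descendants.2 ⟨k, hk⟩) hk

lemma descendants_eq_biUnion_contract (hv : v ∈ P) :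
    descendants f v = {u ∈ descendants f v | u ∈ P}.biUnion (descendants (contract P f)) := by
  refine Subset.antisymm (fun x hx => ?_) (biUnion_subset.2 fun u hu =>
    (descendants_contract_subset P f u).trans (descendants_subset_of_mem (mem_filter.1 hu).1))
  obtain ⟨k, hk⟩ := mem_descendants.1 hx
  by_cases hxP : x ∈ P
  · exact mem_biUnion.2 ⟨x, mem_filter.2 ⟨hx, hxP⟩, self_mem_descendants _ x⟩
  induction k generalizing x with
  | zero =>
    obtain rfl : x = v := hk
    exact absurd hv hxP
  | succ k ih =>
    have hfx : f x ∈ descendants f v := mem_descendants.2 ⟨k, hk⟩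
    suffices ∃ u ∈ ({u ∈ descendants f v | u ∈ P} : Finset V),
        f x ∈ descendants (contract P f) u by
      obtain ⟨u, hu, hxu⟩ := this
      refine mem_biUnion.2 ⟨u, hu, mem_descendants_of_apply_mem ?_⟩
      rwa [contract_of_notMem hxP]
    by_cases hfxP : f x ∈ P
    · exact ⟨f x, mem_filter.2 ⟨hfx, hfxP⟩, self_mem_descendants _ _⟩
    · exact mem_biUnion.1 (ih _ hfx hk hfxP)

lemma disjoint_descendants_of_mem_fixedPoints (hv : v ∈ fixedPoints f) (hx : x ∈ fixedPoints f)
    (hne : v ≠ x) : Disjoint (descendants f v) (descendants f x) := by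
  refine disjoint_left.2 fun y hyv hyx => hne ?_
  obtain ⟨i, rfl⟩ := mem_descendants.1 hyv
  obtain ⟨j, rfl⟩ := mem_descendants.1 hyx
  rw [← iterate_fixed hv j, ← iterate_fixed hx i, ← iterate_add_apply, ← iterate_add_apply,
    add_comm]

variable [AddCommMonoid M]

lemma descendantSum_eq_sum_contract (d : V → M) (hv : v ∈ P) :
    descendantSum f d v =
      ∑ u ∈ descendants f v with u ∈ P, descendantSum (contract P f) d u := by
  have hdisj : Set.PairwiseDisjoint ({u ∈ descendants f v | u ∈ P} : Finset V)
      (descendants (contract P f)) := fun u hu u' hu' hne =>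
    disjoint_descendants_of_mem_fixedPoints (contract_of_mem (mem_filter.1 hu).2)
      (contract_of_mem (mem_filter.1 hu').2) hne
  exact (congrArg (∑ x ∈ ·, d x) (descendants_eq_biUnion_contract hv)).trans (sum_biUnion hdisj)

variable [LE M] {d : V → M}

/-- All sets of descendants have nonnegative weight.  For the weight `excess s`, this is Hall's
condition for `s` to be a parking function. -/
def IsBalanced (f : V → V) (d : V → M) : Prop := ∀ v, 0 ≤ descendantSum f d v

/-- The map `g` is a forest such that the descendants of every vertex that is not a root have
nonnegative weight. -/
def IsBalancedForest (g : V → V) (d : V → M) : Prop :=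
  IsForest g ∧ ∀ v ∉ fixedPoints g, 0 ≤ descendantSum g d v

lemma IsCore.isBalanced_iff (hP : IsCore f P) :
    IsBalanced f d ↔ IsBalancedForest (contract P f) d ∧
      ∀ v ∈ P, 0 ≤ ∑ u ∈ descendants f v with u ∈ P, descendantSum (contract P f) d u := by
  rw [IsBalancedForest, hP.fixedPoints_contract, and_iff_right hP.isForest_contract]
  have hsum {v} (hv : v ∉ P) : descendantSum (contract P f) d v = descendantSum f d v := by
    rw [descendantSum, descendants_contract_of_notMem hP.mapsTo hv, descendantSum]
  refine ⟨fun h => ⟨fun v hv => hsum hv ▸ h v, fun v hv => ?_⟩, fun h v => ?_⟩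
  · exact descendantSum_eq_sum_contract d hv ▸ h v
  · by_cases hv : v ∈ P
    · exact descendantSum_eq_sum_contract d hv ▸ h.2 v hv
    · exact hsum hv ▸ h.1 v hv

end Cores

section FunctionFibers

variable {V M : Type*} {f g : V → V} {P : Set V} {v : V}

lemma isCore_periodicPts [Finite V] (f : V → V) : IsCore f (periodicPts f) := by
  refine ⟨(bijOn_periodicPts f).mapsTo, fun v => ?_⟩
  obtain ⟨i, j, hij, h⟩ : ∃ i j, i < j ∧ f^[i] v = f^[j] v := by
    obtain ⟨i, j, hne, h⟩ := Finite.exists_ne_map_eq_of_infinite (f^[·] v)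
    exact hne.lt_or_gt.elim (fun hij => ⟨i, j, hij, h⟩) fun hji => ⟨j, i, hji, h.symm⟩
  refine ⟨i, mk_mem_periodicPts (Nat.sub_pos_of_lt hij) ?_⟩
  rw [IsPeriodicPt, IsFixedPt, ← iterate_add_apply, Nat.sub_add_cancel hij.le, h]

lemma IsCore.periodicPts_subset (hP : IsCore f P) : periodicPts f ⊆ P := by
  intro v hv
  obtain ⟨n, hn, hv⟩ := mem_periodicPts.1 hv
  obtain ⟨k, hk⟩ := hP.exists_iterate_mem v
  have hk' : f^[n * k] v ∈ P := by
    rw [← Nat.sub_add_cancel (Nat.le_mul_of_pos_left k hn), iterate_add_apply]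
    exact hP.mapsTo.iterate _ hk
  rwa [(hv.mul_const k).eq] at hk'

lemma IsCore.periodicPts_eq_of_injOn [Finite V] (hP : IsCore f P) (hf : Set.InjOn f P) :
    periodicPts f = P := by
  refine hP.periodicPts_subset.antisymm fun v hv => ?_
  have hinj : Injective (hP.mapsTo.restrict f P P) := hP.mapsTo.restrict_inj.2 hf
  exact Semiconj.mapsTo_periodicPts (g := Subtype.val) (fun _ => rfl) (hinj.mem_periodicPts ⟨v, hv⟩)

variable [Fintype V]

lemma filter_descendants_eq_descendants_perm {σ : Perm V} (hσ : ∀ x ∉ P, σ x = x)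
    (hf : Set.EqOn f σ P) (hv : v ∈ P) :
    ({u ∈ descendants f v | u ∈ P} : Finset V) = descendants σ v := by
  have hiter (k : ℕ) {u : V} (hu : u ∈ P) : f^[k] u = σ^[k] u := by
    induction k generalizing u with
    | zero => rfl
    | succ k ih =>
      rw [iterate_succ_apply, iterate_succ_apply, hf hu,
        ih ((apply_mem_iff_of_forall_notMem hσ).2 hu)]
  ext u
  simp only [mem_filter, mem_descendants]
  by_cases hu : u ∈ P
  · simp only [hiter _ hu, hu, and_true]
  · simp only [iterate_fixed (hσ u hu), hu, and_false, exists_const, false_iff]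
    rintro rfl
    exact hu hv

lemma IsCore.isBalanced_iff_mem_nonnegPerms [AddCommMonoid M] [LinearOrder M] {d : V → M}
    {σ : Perm V} (hP : IsCore f P) (hσ : ∀ x ∉ P, σ x = x) (hf : Set.EqOn f σ P) :
    IsBalanced f d ↔ IsBalancedForest (contract P f) d ∧
      σ ∈ nonnegPerms (descendantSum (contract P f) d) (roots (contract P f)) := by
  have hmem (v) : v ∈ roots (contract P f) ↔ v ∈ P := by
    rw [mem_roots, hP.fixedPoints_contract]
  simp only [hP.isBalanced_iff, mem_nonnegPerms, hmem]
  refine and_congr_right fun _ => ?_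
  rw [and_iff_right hσ]
  refine forall₂_congr fun v hv => ?_
  rw [filter_descendants_eq_descendants_perm hσ hf hv]
  rfl

lemma card_isBalanced_contract_periodicPts_eq [AddCommMonoid M] [LinearOrder M] {d : V → M}
    (hg : IsBalancedForest g d) :
    #{f | IsBalanced f d ∧ contract (periodicPts f) f = g} =
      #(nonnegPerms (descendantSum g d) (roots g)) := by
  symm
  refine card_bij (fun σ _ => glue σ g) (fun σ hσ => ?_) (fun σ hσ τ hτ h => ?_) fun f hf => ?_
  · have hfix : ∀ x ∉ fixedPoints g, σ x = x := fun x hx =>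
      (mem_nonnegPerms.1 hσ).1 x (mt mem_roots.1 hx)
    have hcore : IsCore (glue σ g) (fixedPoints g) :=
      hg.1.isCore_glue fun x => (apply_mem_iff_of_forall_notMem hfix).2
    have hper : periodicPts (glue σ g) = fixedPoints g :=
      hcore.periodicPts_eq_of_injOn (σ.injective.injOn.congr (eqOn_glue σ g).symm)
    rw [mem_filter_univ, hper, hcore.isBalanced_iff_mem_nonnegPerms hfix (eqOn_glue σ g),
      contract_glue]
    exact ⟨⟨hg, hσ⟩, rfl⟩
  · ext x
    by_cases hx : x ∈ fixedPoints g
    · rw [← eqOn_glue σ g hx, h, eqOn_glue τ g hx]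
    · rw [(mem_nonnegPerms.1 hσ).1 x (mt mem_roots.1 hx),
        (mem_nonnegPerms.1 hτ).1 x (mt mem_roots.1 hx)]
  · obtain ⟨hbal, rfl⟩ := (mem_filter_univ f).1 hf
    have hcore := isCore_periodicPts f
    have hfix : ∀ x ∉ periodicPts f, Perm.ofSubtype (bijOn_periodicPts f).equiv x = x := fun x =>
      Perm.ofSubtype_apply_of_not_mem _
    have hEq : Set.EqOn f (Perm.ofSubtype (bijOn_periodicPts f).equiv) (periodicPts f) :=
      fun x hx => by rw [Perm.ofSubtype_apply_of_mem _ hx]; rfl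
    exact ⟨_, ((hcore.isBalanced_iff_mem_nonnegPerms hfix hEq).1 hbal).2,
      hcore.glue_contract hEq.symm⟩

end FunctionFibers

section TreeFibers

variable {V M : Type*} {g p : V → V} {u v w : V} {l l' t s : List V}

/-- The vertices visited by iterating `p` from `w`, listed in order up to the first fixed point.
For a tree, this is the path from `w` to the root. -/
inductive IsTrajectory (p : V → V) : V → List V → Prop
  | singleton {w : V} (hw : p w = w) : IsTrajectory p w [w]
  | cons {w : V} {l : List V} (hl : IsTrajectory p (p w) l) (hw : w ∉ l) : IsTrajectory p w (w :: l)

namespace IsTrajectory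

lemma nodup (h : IsTrajectory p w l) : l.Nodup := by
  induction h with
  | singleton => exact List.nodup_singleton _
  | cons _ hw ih => exact List.nodup_cons.2 ⟨hw, ih⟩

lemma head?_eq (h : IsTrajectory p w l) : l.head? = some w := by cases h <;> rfl

lemma start_mem (h : IsTrajectory p w l) : w ∈ l := List.mem_of_head? h.head?_eq

lemma mapsTo (h : IsTrajectory p w l) : Set.MapsTo p {v | v ∈ l} {v | v ∈ l} := by
  induction h with
  | singleton hw =>
    intro v hv
    obtain rfl := List.mem_singleton.1 hv
    exact List.mem_singleton.2 hw
  | cons hl _ ih =>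
    intro v hv
    rcases List.mem_cons.1 hv with rfl | hv
    · exact List.mem_cons_of_mem _ hl.start_mem
    · exact List.mem_cons_of_mem _ (ih hv)

lemma exists_iterate_eq (h : IsTrajectory p w l) (hv : v ∈ l) : ∃ k, p^[k] w = v := by
  induction h with
  | singleton => exact ⟨0, (List.mem_singleton.1 hv).symm⟩
  | cons _ _ ih =>
    rcases List.mem_cons.1 hv with rfl | hv
    · exact ⟨0, rfl⟩
    · obtain ⟨k, hk⟩ := ih hv
      exact ⟨k + 1, hk⟩

lemma range_iterate (h : IsTrajectory p w l) : Set.range (p^[·] w) = {v | v ∈ l} :=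
  Set.Subset.antisymm (Set.range_subset_iff.2 fun k => h.mapsTo.iterate k h.start_mem)
    fun _ => h.exists_iterate_eq

lemma unique (h : IsTrajectory p w l) (h' : IsTrajectory p w l') : l = l' := by
  induction h generalizing l' with
  | singleton hw =>
    cases h' with
    | singleton => rfl
    | cons hl hw' => exact absurd (hw ▸ hl.start_mem) hw'
  | cons hl hw' ih =>
    cases h' with
    | singleton hw => exact absurd (hw ▸ hl.start_mem) hw'
    | cons hl' => rw [ih hl']

lemma exists_of_mem (h : IsTrajectory p w l) (hv : v ∈ l) : ∃ l', IsTrajectory p v l' := by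
  induction h with
  | @singleton w hw =>
    obtain rfl := List.mem_singleton.1 hv
    exact ⟨[v], .singleton hw⟩
  | cons hl hw ih =>
    rcases List.mem_cons.1 hv with rfl | hv
    · exact ⟨_, .cons hl hw⟩
    · exact ih hv

lemma apply_eq_nextOr (h : IsTrajectory p w l) (hv : v ∈ l) : p v = l.nextOr v v := by
  induction h with
  | singleton hw => rw [List.mem_singleton.1 hv, hw, List.nextOr_singleton]
  | @cons w l hl hw ih =>
    rcases eq_or_ne v w with rfl | hne
    · cases hl <;> rw [List.nextOr_self_cons_cons]
    · rw [List.nextOr_cons_of_ne _ _ _ _ hne, ih ((List.mem_cons.1 hv).resolve_left hne)]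

/-- Iteration from a vertex listed after `v` never comes back to `v`. -/
lemma exists_iterate_eq_iff (h : IsTrajectory p w (t ++ v :: s)) (hu : u ∈ t ++ v :: s) :
    (∃ k, p^[k] u = v) ↔ u ∈ t ++ [v] := by
  induction t generalizing w with
  | nil =>
    rw [List.nil_append] at h hu ⊢
    rw [List.mem_singleton]
    refine ⟨?_, fun huv => ⟨0, huv⟩⟩
    rintro ⟨k, hk⟩
    cases h with
    | singleton => exact List.mem_singleton.1 hu
    | cons hl hv =>
      exact (List.mem_cons.1 hu).resolve_right fun hus => hv (hk ▸ hl.mapsTo.iterate k hus)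
  | cons x t ih =>
    obtain rfl : x = w := Option.some.inj h.head?_eq
    rcases eq_or_ne u x with rfl | hne
    · exact iff_of_true (h.exists_iterate_eq (by simp)) List.mem_cons_self
    · rw [List.cons_append] at h hu ⊢
      generalize hl : t ++ v :: s = l at *
      cases h with
      | singleton => simp at hl
      | cons hl' =>
        subst hl
        rw [ih hl' ((List.mem_cons.1 hu).resolve_left hne), List.mem_cons, or_iff_right hne]

lemma exists_forall_iterate_eq (h : IsTrajectory p w l) :
    ∃ r, p r = r ∧ ∀ v ∈ l, ∃ k, p^[k] v = r := by
  induction h with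
  | singleton hw => exact ⟨_, hw, fun v hv => ⟨0, List.mem_singleton.1 hv⟩⟩
  | cons hl _ ih =>
    obtain ⟨r, hr, hk⟩ := ih
    refine ⟨r, hr, List.forall_mem_cons.2 ⟨?_, hk⟩⟩
    obtain ⟨k, hk⟩ := hk _ hl.start_mem
    exact ⟨k + 1, hk⟩

end IsTrajectory

lemma isTrajectory_of_forall_apply_eq_nextOr (hne : l ≠ []) (hl : l.Nodup)
    (hp : ∀ v ∈ l, p v = l.nextOr v v) : IsTrajectory p (l.head hne) l := by
  induction l with
  | nil => contradiction
  | cons w l ih =>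
    obtain ⟨hw, hl⟩ := List.nodup_cons.1 hl
    cases l with
    | nil => exact .singleton (hp w List.mem_cons_self)
    | cons x l =>
      obtain rfl : x = p w := by rw [hp w List.mem_cons_self, List.nextOr_self_cons_cons]
      refine .cons (ih (List.cons_ne_nil _ l) hl fun v hv => ?_) hw
      rw [hp v (List.mem_cons_of_mem w hv),
        List.nextOr_cons_of_ne _ _ _ _ (ne_of_mem_of_not_mem hv hw)]

lemma isTrajectory_glue_nextOr (hne : l ≠ []) (hl : l.Nodup) (hg : ∀ v ∈ l, g v = v) :
    IsTrajectory (glue (fun v => l.nextOr v v) g) (l.head hne) l :=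
  isTrajectory_of_forall_apply_eq_nextOr hne hl fun v hv => eqOn_glue _ g (hg v hv)

lemma IsTree.exists_isTrajectory (hp : IsTree p) (w : V) : ∃ l, IsTrajectory p w l := by
  obtain ⟨r, hr⟩ := hp
  obtain ⟨k, hk⟩ := hr.exists_iterate_mem w
  induction k generalizing w with
  | zero =>
    obtain rfl : w = r := hk
    exact ⟨[w], .singleton (hr.mapsTo rfl)⟩
  | succ k ih =>
    obtain ⟨l, hl⟩ := ih (p w) hk
    by_cases hw : w ∈ l
    · exact hl.exists_of_mem hw
    · exact ⟨w :: l, hl.cons hw⟩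

lemma IsTrajectory.isTree (hl : IsTrajectory p w l) (hcore : IsCore p {v | v ∈ l}) : IsTree p := by
  obtain ⟨r, hr, hlr⟩ := hl.exists_forall_iterate_eq
  refine ⟨r, Set.mapsTo_singleton.2 hr, fun v => ?_⟩
  obtain ⟨j, hj⟩ := hcore.exists_iterate_mem v
  obtain ⟨k, hk⟩ := hlr _ hj
  exact ⟨k + j, by rwa [iterate_add_apply]⟩

variable [Fintype V] [AddCommMonoid M] [LinearOrder M] {d : V → M}

lemma IsTrajectory.hasNonnegPrefixes_iff (h : IsTrajectory p w l) (c : V → M) :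
    HasNonnegPrefixes c l ↔ ∀ v ∈ l, 0 ≤ ∑ u ∈ descendants p v with u ∈ l, c u := by
  have hsum {t v s} (hl : l = t ++ v :: s) :
      ∑ u ∈ descendants p v with u ∈ l, c u = ((t ++ [v]).map c).sum := by
    subst hl
    have hprefix : t ++ [v] <+: t ++ v :: s := ⟨s, by rw [List.append_assoc, List.singleton_append]⟩
    rw [← List.sum_toFinset c (h.nodup.sublist hprefix.sublist)]
    refine sum_congr (Finset.ext fun u => ?_) fun _ _ => rfl
    rw [mem_filter, mem_descendants, List.mem_toFinset]
    exact ⟨fun hu => (h.exists_iterate_eq_iff hu.2).1 hu.1,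
      fun hu => ⟨(h.exists_iterate_eq_iff (hprefix.subset hu)).2 hu, hprefix.subset hu⟩⟩
  refine ⟨fun hc v hv => ?_, fun hc q hq => ?_⟩
  · obtain ⟨t, s, hl⟩ := List.append_of_mem hv
    rw [hsum hl]
    exact hc _ ⟨s, by simp [hl]⟩
  · obtain ⟨s, hl⟩ := hq
    rcases List.eq_nil_or_concat q with rfl | ⟨t, v, rfl⟩
    · rfl
    · rw [List.concat_eq_append] at hl ⊢
      rw [← hsum (s := s) (by rw [← hl, List.append_assoc, List.singleton_append])]
      exact hc v (by simp [← hl])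

lemma IsTrajectory.isBalanced_iff_mem_nonnegOrderings (h : IsTrajectory p w l)
    (hcore : IsCore p {v | v ∈ l}) :
    IsBalanced p d ↔ IsBalancedForest (contract {v | v ∈ l} p) d ∧
      l ∈ nonnegOrderings (descendantSum (contract {v | v ∈ l} p) d)
        (roots (contract {v | v ∈ l} p)) := by
  have hroots : l.toFinset = roots (contract {v | v ∈ l} p) := by
    ext v
    rw [List.mem_toFinset, mem_roots, hcore.fixedPoints_contract]
    rfl
  rw [hcore.isBalanced_iff, mem_nonnegOrderings, and_iff_right (a := _ ∧ _) ⟨h.nodup, hroots⟩,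
    h.hasNonnegPrefixes_iff]
  simp only [Set.mem_ofPred_eq]

lemma card_isTree_isBalanced_contract_range_eq [Nonempty V] (hg : IsBalancedForest g d) :
    #{q : (V → V) × V | (IsTree q.1 ∧ IsBalanced q.1 d) ∧
        contract (Set.range (q.1^[·] q.2)) q.1 = g} =
      #(nonnegOrderings (descendantSum g d) (roots g)) := by
  have hne (l : List V) (hl : l ∈ nonnegOrderings (descendantSum g d) (roots g)) : l ≠ [] := by
    rintro rfl
    exact hg.1.roots_nonempty.ne_empty (mem_nonnegOrderings.1 hl).1.2.symm
  have hmem (l : List V) (hl : l ∈ nonnegOrderings (descendantSum g d) (roots g)) (v : V) :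
      v ∈ l ↔ v ∈ fixedPoints g := by
    rw [← List.mem_toFinset, (mem_nonnegOrderings.1 hl).1.2, mem_roots]
  have htraj (l : List V) (hl : l ∈ nonnegOrderings (descendantSum g d) (roots g)) :
      IsTrajectory (glue (fun v => l.nextOr v v) g) (l.head (hne l hl)) l :=
    isTrajectory_glue_nextOr _ (mem_nonnegOrderings.1 hl).1.1 fun v => (hmem l hl v).1
  symm
  refine card_bij (fun l hl => (glue (fun v => l.nextOr v v) g, l.head (hne l hl)))
    (fun l hl => ?_) (fun l hl l' hl' h => ?_) fun ⟨p, w⟩ hq => ?_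
  · have hfix : {v | v ∈ l} = fixedPoints g := Set.ext (hmem l hl)
    have hcore : IsCore (glue (fun v => l.nextOr v v) g) {v | v ∈ l} :=
      hfix ▸ hg.1.isCore_glue (hfix ▸ fun v hv => List.nextOr_mem hv)
    rw [mem_filter_univ, (htraj l hl).range_iterate,
      (htraj l hl).isBalanced_iff_mem_nonnegOrderings hcore, hfix, contract_glue]
    exact ⟨⟨(htraj l hl).isTree hcore, hg, hl⟩, rfl⟩
  · obtain ⟨hglue, hhead⟩ := Prod.mk.inj h
    exact (htraj l hl).unique (hglue ▸ hhead ▸ htraj l' hl')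
  · obtain ⟨⟨htree, hbal⟩, hg'⟩ := (mem_filter_univ _).1 hq
    obtain ⟨l, hl⟩ := htree.exists_isTrajectory w
    have hcore := htree.isCore_range_iterate w
    rw [hl.range_iterate] at hcore hg'
    subst hg'
    refine ⟨l, ((hl.isBalanced_iff_mem_nonnegOrderings hcore).1 hbal).2, Prod.ext ?_ ?_⟩
    · exact hcore.glue_contract fun v hv => (hl.apply_eq_nextOr hv).symm
    · exact Option.some.inj ((List.head?_eq_some_head _).symm.trans hl.head?_eq)

end TreeFibers

theorem card_mul_card_isTree_isBalanced {V M : Type*} [Fintype V] [Nonempty V] [AddCommMonoid M]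
    [LinearOrder M] [IsOrderedAddMonoid M] (d : V → M) :
    Fintype.card V * #{p | IsTree p ∧ IsBalanced p d} = #{f | IsBalanced f d} := by
  have hpairs : Fintype.card V * #{p | IsTree p ∧ IsBalanced p d} =
      #{q : (V → V) × V | IsTree q.1 ∧ IsBalanced q.1 d} := by
    rw [← card_univ, mul_comm, ← card_product]
    congr 1
    ext q
    simp
  rw [hpairs, card_eq_sum_card_fiberwise (t := {g | IsBalancedForest g d})
      (f := fun q : (V → V) × V => contract (Set.range (q.1^[·] q.2)) q.1) fun q hq => ?_,
    card_eq_sum_card_fiberwise (t := {g | IsBalancedForest g d})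
      (f := fun f => contract (periodicPts f) f) fun f hf => ?_]
  · refine sum_congr rfl fun g hg => ?_
    have hg := (mem_filter_univ g).1 hg
    rw [filter_filter, filter_filter, card_isTree_isBalanced_contract_range_eq hg,
      card_isBalanced_contract_periodicPts_eq hg, card_nonnegOrderings_eq_card_nonnegPerms]
  · rw [mem_coe, mem_filter_univ] at hf ⊢
    exact ((isCore_periodicPts f).isBalanced_iff.1 hf).1
  · rw [mem_coe, mem_filter_univ] at hq ⊢
    exact ((hq.1.isCore_range_iterate q.2).isBalanced_iff.1 hq.2).1

section Parking

variable {V : Type*} {D : Digraph V} {occ : Set V} {v x : V} {m : ℕ}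

lemma ParksAt.notMem (h : ParksAt D occ v x) : x ∉ occ := by
  induction h with
  | park hv => exact hv
  | drive _ _ _ ih => exact ih

lemma ParksAt.reflTransGen (h : ParksAt D occ v x) : ReflTransGen D.Adj v x := by
  induction h with
  | park => exact .refl
  | drive _ hvw _ ih => exact .head hvw ih

lemma exists_parksAt_reflTransGen (h : ReflTransGen D.Adj v x) (hx : x ∉ occ) :
    ∃ y, ParksAt D occ v y ∧ ReflTransGen D.Adj y x := by
  induction h using ReflTransGen.head_induction_on with
  | refl => exact ⟨x, .park hx, .refl⟩
  | @head v w hvw hwx ih =>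
    by_cases hv : v ∈ occ
    · obtain ⟨y, hy, hyx⟩ := ih
      exact ⟨y, .drive hv hvw hy, hyx⟩
    · exact ⟨v, .park hv, .head hvw hwx⟩

/-- If the first driver parks at `y` on the way to her assigned vertex `q 0`, then the driver to
whom `y` is assigned, if there is one, can go on to `q 0`. -/
lemma exists_forall_parksAt_of_injective {s q : Fin m → V} (hq : Injective q)
    (hsq : ∀ i, ReflTransGen D.Adj (s i) (q i)) (hocc : ∀ i, q i ∉ occ) :
    ∃ p : Fin m → V, ∀ i, ParksAt D (occ ∪ {x | ∃ j < i, p j = x}) (s i) (p i) := by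
  induction m generalizing occ with
  | zero => exact ⟨q, fun i => i.elim0⟩
  | succ m ih =>
    obtain ⟨y, hy, hyq⟩ := exists_parksAt_reflTransGen (hsq 0) (hocc 0)
    have hne (i : Fin m) : q i.succ ≠ q 0 := hq.ne (Fin.succ_ne_zero i)
    have hreach (i : Fin m) : ReflTransGen D.Adj (s i.succ) (swap (q 0) y (q i.succ)) := by
      rcases eq_or_ne (q i.succ) y with hy' | hy'
      · rw [hy', swap_apply_right]
        exact (hy' ▸ hsq i.succ).trans hyq
      · rw [swap_apply_of_ne_of_ne (hne i) hy']
        exact hsq i.succ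
    have hfree (i : Fin m) : swap (q 0) y (q i.succ) ∉ insert y occ := by
      rcases eq_or_ne (q i.succ) y with hy' | hy'
      · rw [hy', swap_apply_right, Set.mem_insert_iff, not_or]
        exact ⟨hy' ▸ (hne i).symm, hocc 0⟩
      · rw [swap_apply_of_ne_of_ne (hne i) hy', Set.mem_insert_iff, not_or]
        exact ⟨hy', hocc i.succ⟩
    obtain ⟨p, hp⟩ := ih (((swap (q 0) y).injective.comp hq).comp (Fin.succ_injective m))
      hreach hfree
    refine ⟨Fin.cons y p, Fin.cases (by simpa using hy) fun i => ?_⟩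
    rw [Fin.cons_succ]
    convert hp i using 1
    ext x
    simp [Fin.exists_fin_succ, or_assoc, or_left_comm, eq_comm]

lemma isParkingFunction_iff_exists_injective {s : Fin m → V} : IsParkingFunction D s ↔
    ∃ q : Fin m → V, Injective q ∧ ∀ i, ReflTransGen D.Adj (s i) (q i) := by
  refine ⟨fun ⟨p, hp⟩ => ⟨p, .of_lt_imp_ne fun i j hij hpij => ?_, fun i => (hp i).reflTransGen⟩,
    fun ⟨q, hq, hsq⟩ => ?_⟩
  · exact (hp j).notMem ⟨i, hij, hpij⟩
  · simpa [IsParkingFunction] using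
      exists_forall_parksAt_of_injective hq hsq fun i => Set.notMem_empty (q i)

/-- Every edge of `D` into a vertex `v` comes from `f v`, and there is one unless `f v = v`.  This
covers source trees, whose roots are sent to themselves, and inverse mapping digraphs, which may
have loops. -/
structure IsParentMap (D : Digraph V) (f : V → V) : Prop where
  eq_of_adj : ∀ {u v}, D.Adj u v → u = f v
  adj_of_ne : ∀ {v}, f v ≠ v → D.Adj (f v) v

lemma IsParentMap.reflTransGen_iff {f : V → V} (hf : IsParentMap D f) :
    ReflTransGen D.Adj v x ↔ ∃ k, f^[k] x = v := by
  constructor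
  · intro h
    induction h with
    | refl => exact ⟨0, rfl⟩
    | tail _ hadj ih =>
      obtain ⟨k, hk⟩ := ih
      exact ⟨k + 1, by rwa [iterate_succ_apply, ← hf.eq_of_adj hadj]⟩
  · rintro ⟨k, rfl⟩
    induction k with
    | zero => exact .refl
    | succ k ih =>
      rw [iterate_succ_apply']
      by_cases hk : f (f^[k] x) = f^[k] x
      · rwa [hk]
      · exact .head (hf.adj_of_ne hk) ih

/-- One minus the number of drivers who start at `x`.  A set of vertices has nonnegative total
excess if and only if it offers enough room for the drivers who start in it. -/
noncomputable def excess (s : Fin m → V) (x : V) : ℤ := 1 - #{i | s i = x}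

lemma sum_excess (s : Fin m → V) (W : Finset V) :
    ∑ x ∈ W, excess s x = #W - #{i | s i ∈ W} := by
  have hfiber : #{i | s i ∈ W} = ∑ x ∈ W, #{i | s i = x} := by
    simp only [card_filter]
    rw [sum_comm]
    simp only [sum_ite_eq]
  simp only [excess, sum_sub_distrib, hfiber, Nat.cast_sum, sum_const, nsmul_one]

lemma IsParentMap.isParkingFunction_iff_isBalanced [Fintype V] {f : V → V} (hf : IsParentMap D f)
    (s : Fin m → V) : IsParkingFunction D s ↔ IsBalanced f (excess s) := by
  have hall : IsParkingFunction D s ↔ ∀ A : Finset (Fin m),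
      #A ≤ #(A.biUnion fun i => descendants f (s i)) := by
    simp only [isParkingFunction_iff_exists_injective, hf.reflTransGen_iff, ← mem_descendants,
      all_card_le_biUnion_card_iff_exists_injective]
  rw [hall]
  refine ⟨fun h v => ?_, fun h A => ?_⟩
  · rw [descendantSum, sum_excess, sub_nonneg, Nat.cast_le]
    refine (h _).trans (card_le_card (biUnion_subset.2 fun i hi => ?_))
    exact descendants_subset_of_mem ((mem_filter_univ i).1 hi)
  · rcases A.eq_empty_or_nonempty with rfl | hA
    · exact Nat.zero_le _
    set W := A.biUnion fun i => descendants f (s i)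
    have hAW : A ⊆ univ.filter (s · ∈ W) := fun i hi =>
      (mem_filter_univ i).2 (mem_biUnion.2 ⟨i, hi, self_mem_descendants f _⟩)
    have hW : 0 ≤ ∑ x ∈ W, excess s x := by
      refine sum_mem_of_forall_descendantSum_mem (AddSubmonoid.nonneg ℤ).toAddSubsemigroup
        (f := f) ?_ (fun x hx => ?_) fun v _ => h v
      · exact hA.biUnion fun i _ => ⟨_, self_mem_descendants f _⟩
      · obtain ⟨i, hi, hx⟩ := mem_biUnion.1 hx
        exact mem_biUnion.2 ⟨i, hi, mem_descendants_of_apply_mem hx⟩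
    rw [sum_excess, sub_nonneg, Nat.cast_le] at hW
    exact (card_le_card hAW).trans hW

end Parking

section Digraphs

variable {V : Type*} {D : Digraph V}

lemma isParentMap_inverseMappingDigraph (f : V → V) : IsParentMap (inverseMappingDigraph f) f :=
  ⟨id, fun _ => rfl⟩

lemma inverseMappingDigraph_injective :
    Injective (inverseMappingDigraph : (V → V) → Digraph V) := by
  intro f g h
  ext v
  have hadj : (inverseMappingDigraph g).Adj (f v) v := h ▸ rfl
  exact hadj

/-- The digraph with an edge from the parent `p v` to `v` for every `v` that is not a root.  For a
tree `p`, it is the corresponding source tree. -/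
def parentDigraph (p : V → V) : Digraph V where
  Adj u v := u = p v ∧ p v ≠ v

lemma isParentMap_parentDigraph (p : V → V) : IsParentMap (parentDigraph p) p :=
  ⟨And.left, fun h => ⟨rfl, h⟩⟩

lemma parentDigraph_injective : Injective (parentDigraph : (V → V) → Digraph V) := by
  intro p q h
  ext v
  by_cases hp : p v = v
  · by_cases hq : q v = v
    · rw [hp, hq]
    · have hadj : (parentDigraph p).Adj (q v) v := h ▸ ⟨rfl, hq⟩
      exact hadj.1.symm
  · have hadj : (parentDigraph q).Adj (p v) v := h ▸ ⟨rfl, hp⟩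
    exact hadj.1

lemma IsTree.isSourceTree_parentDigraph {p : V → V} (hp : IsTree p) :
    IsSourceTree (parentDigraph p) := by
  obtain ⟨r, hr⟩ := hp
  have hfix {v} (hv : p v = v) : v = r := hr.fixedPoints_subset hv
  exact ⟨r, fun u h => h.2 (hr.mapsTo rfl),
    fun v hv => ⟨p v, ⟨rfl, fun h => hv (hfix h)⟩, fun u h => h.1⟩,
    fun v => (isParentMap_parentDigraph p).reflTransGen_iff.2 (hr.exists_iterate_mem v)⟩

lemma IsSourceTree.exists_isTree (hD : IsSourceTree D) : ∃ p, IsTree p ∧ parentDigraph p = D := by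
  obtain ⟨r, hr, hpar, hreach⟩ := hD
  choose! p hp hpu using hpar
  have hne {v} (hv : v ≠ r) : p v ≠ v := by
    intro hpv
    have hloop {u} (hu : ReflTransGen D.Adj u v) : u = v := by
      induction hu using ReflTransGen.head_induction_on with
      | refl => rfl
      | head hadj _ ih =>
        subst ih
        exact (hpu _ hv _ hadj).trans hpv
    exact hv (hloop (hreach v)).symm
  have hD : parentDigraph (update p r r) = D := by
    ext u v
    change u = update p r r v ∧ update p r r v ≠ v ↔ _
    rcases eq_or_ne v r with rfl | hv
    · simp [hr]
    · rw [update_of_ne hv, and_iff_left (hne hv)]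
      exact ⟨fun h => h ▸ hp v hv, hpu v hv u⟩
  refine ⟨update p r r, ⟨r, Set.mapsTo_singleton.2 (update_self ..), fun v => ?_⟩, hD⟩
  exact (isParentMap_parentDigraph _).reflTransGen_iff.1 (hD ▸ hreach v)

lemma isSourceTree_iff : IsSourceTree D ↔ ∃ p, IsTree p ∧ parentDigraph p = D :=
  ⟨IsSourceTree.exists_isTree, fun ⟨_, hp, h⟩ => h ▸ hp.isSourceTree_parentDigraph⟩

variable [Fintype V] {m : ℕ}

lemma ncard_isSourceTree_isParkingFunction (s : Fin m → V) :
    {D : Digraph V | IsSourceTree D ∧ IsParkingFunction D s}.ncard =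
      #{p | IsTree p ∧ IsBalanced p (excess s)} := by
  rw [← Set.ncard_coe_finset, ← Set.ncard_image_of_injective _ parentDigraph_injective]
  congr 1
  ext D
  rw [Set.mem_ofPred_eq, isSourceTree_iff, Set.mem_image, ← exists_and_right]
  refine exists_congr fun p => ?_
  rw [mem_coe, mem_filter_univ, and_right_comm]
  refine and_congr_left ?_
  rintro rfl
  rw [(isParentMap_parentDigraph p).isParkingFunction_iff_isBalanced]

lemma ncard_range_isParkingFunction (s : Fin m → V) :
    {D | D ∈ Set.range inverseMappingDigraph ∧ IsParkingFunction D s}.ncard =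
      #{f : V → V | IsBalanced f (excess s)} := by
  rw [← Set.ncard_coe_finset, ← Set.ncard_image_of_injective _ inverseMappingDigraph_injective]
  congr 1
  ext D
  rw [Set.mem_ofPred_eq, Set.mem_range, Set.mem_image, ← exists_and_right]
  refine exists_congr fun f => ?_
  rw [mem_coe, mem_filter_univ, and_comm]
  refine and_congr_left ?_
  rintro rfl
  rw [(isParentMap_inverseMappingDigraph f).isParkingFunction_iff_isBalanced]

lemma sum_numParking {n : ℕ} (𝒟 : Set (Digraph (Fin n))) (m : ℕ) :
    ∑ D : Digraph (Fin n) with D ∈ 𝒟, numParking D m =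
      ∑ s : Fin m → Fin n, {D | D ∈ 𝒟 ∧ IsParkingFunction D s}.ncard := by
  convert sum_card_bipartiteAbove_eq_sum_card_bipartiteBelow
    (s := ({D | D ∈ 𝒟} : Finset (Digraph (Fin n)))) (t := (univ : Finset (Fin m → Fin n)))
    (IsParkingFunction · ·) using 2 with D _ s
  · rw [numParking, Nat.card_eq_fintype_card, Fintype.card_subtype, bipartiteAbove]
  · rw [← Set.ncard_coe_finset, bipartiteBelow, filter_filter, coe_filter_univ]

end Digraphs

end DigraphParking

theorem mainTheorem1_general {V : Type*} [Finite V] [Nonempty V] {m : ℕ} (s : Fin m → V) :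
    Nat.card V * {D : Digraph V | DigraphParking.IsSourceTree D ∧
      DigraphParking.IsParkingFunction D s}.ncard =
    {D : Digraph V | D ∈ Set.range DigraphParking.inverseMappingDigraph ∧
      DigraphParking.IsParkingFunction D s}.ncard := by
  have := Fintype.ofFinite V
  rw [DigraphParking.ncard_isSourceTree_isParkingFunction,
    DigraphParking.ncard_range_isParkingFunction, Nat.card_eq_fintype_card,
    DigraphParking.card_mul_card_isTree_isBalanced]

theorem mainTheorem1 (n m : ℕ) (hn : 1 ≤ n) (hm : m ≤ n) :
    n * DigraphParking.sourceTreeTotal n m = DigraphParking.inverseMappingTotal n m := by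
  have : Nonempty (Fin n) := ⟨⟨0, hn⟩⟩
  simp only [DigraphParking.sourceTreeTotal, DigraphParking.inverseMappingTotal,
    DigraphParking.sum_numParking, Finset.mul_sum]
  exact Finset.sum_congr rfl fun s _ =>
    (congrArg (· * _) (Nat.card_fin n).symm).trans (mainTheorem1_general s)
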